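/- Let $A$ be a finite-dimensional formally real Jordan algebra, that is, a finite-dimensional real vector space with a bilinear commutative product $\circ$ such that $(x\circ y)\circ(x\circ x)=x\circ(y\circ(x\circ x))$ for all $x,y\in A$, and such that $\sum_{i=1}^n x_i\circ x_i=0$ implies $x_1=\dots=x_n=0$. The positive cone $A_+$ is the set of all finite sums of squares $\sum_i x_i\circ x_i$. The trace $\mathrm{tr}(x)$ of $x\in A$ is the sum $\sum_i\mu_i$ of its eigenvalues, where $x=\sum_i\mu_i c_i$ with $\mu_i\in\mathbb{R}$ and with $c_i$ pairwise orthogonal primitive idempotents. The state space is $\mathcal S=\{x\in A_+ : \mathrm{tr}(x)=1\}$, and the pure states are the extreme points of $\mathcal S$. A spectrum of $x\in A_+$ is a vector $\lambda_1\ge\lambda_2\ge\dots\ge\lambda_n\ge 0$, with $n$ arbitrary, such that $x=\sum_{i=1}^n\lambda_i\sigma_i$ for some pure states $\sigma_1,\dots,\sigma_n$. The entropy of $x\in A_+$ is \[ H(x)=\inf\Bigl(-\sum_{i=1}^n\lambda_i\ln\lambda_i\Bigr), \] where the infimum is taken over all spectra of $x$ and $0\ln 0=0$. Theorem. For every $x\in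 A_+$ the infimum defining $H(x)$ is taken over a non-empty set that is bounded below, so that $H(x)$ is a well-defined real number, and the entropy function $H$ is a concave function on the convex set $A_+$: for all $x,y\in A_+$ and $t\in[0,1]$, \[ H\bigl((1-t)x+ty\bigr)\ \ge\ (1-t)H(x)+tH(y). \] -/

import Mathlib

noncomputable section

namespace JordanEntropy

variable {A : Type*} [NonUnitalNonAssocCommRing A] [Module ℝ A]

/-- A primitive idempotent: a nonzero idempotent that is not the sum of two nonzero idempotents
with product zero. -/
def IsPrimitiveIdempotent (c : A) : Prop :=
  c ≠ 0 ∧ IsIdempotentElem c ∧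
    ∀ a b : A, IsIdempotentElem a → IsIdempotentElem b → a * b = 0 → a + b = c → a = 0 ∨ b = 0

/-- `x = ∑ i, l i • c i` is a spectral decomposition of `x`: the `c i` are primitive idempotents
and are pairwise orthogonal; the `l i` are real numbers, the eigenvalues of `x` (apart from zeros,
which may be left out). -/
def IsSpectralDecomposition (x : A) (n : ℕ) (c : Fin n → A) (l : Fin n → ℝ) : Prop :=
  (∀ i, IsPrimitiveIdempotent (c i)) ∧ (∀ i j, i ≠ j → c i * c j = 0) ∧ x = ∑ i, l i • c i

open Classical in
/-- The (generic) trace of an element of a finite-dimensional formally real Jordan algebra: the sum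
of its eigenvalues, counted with multiplicity. Every element has a spectral decomposition and all of
them give the same sum; the value is read off from one of them. -/
def trace (x : A) : ℝ :=
  if h : ∃ t : ℝ, ∃ (n : ℕ) (c : Fin n → A) (l : Fin n → ℝ),
      IsSpectralDecomposition x n c l ∧ t = ∑ i, l i
  then h.choose else 0

variable (A) in
/-- The positive cone: the set of all sums of squares. -/
def positiveCone : Set A := {x | IsSumSq x}

variable (A) in
/-- The state space: the positive elements of trace one (density operators). -/
def stateSpace : Set A := {x | x ∈ positiveCone A ∧ trace x = 1}

variable (A) in
/-- The pure states: the extreme points of the state space. -/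
def pureStates : Set A := (stateSpace A).extremePoints ℝ

/-- `l 0 ≥ l 1 ≥ … ≥ l (n - 1) ≥ 0` is the spectrum of some decomposition of `x` into pure states.
The pure states are not required to be orthogonal and there is no restriction on `n`. -/
def IsSpectrum (x : A) (n : ℕ) (l : Fin n → ℝ) : Prop :=
  Antitone l ∧ (∀ i, 0 ≤ l i) ∧
    ∃ σ : Fin n → A, (∀ i, σ i ∈ pureStates A) ∧ x = ∑ i, l i • σ i

/-- The set of values `-∑ i, l i * log (l i)` (with `0 * log 0 = 0`) over all spectra of `x`. -/
def spectrumEntropies (x : A) : Set ℝ :=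
  {h | ∃ (n : ℕ) (l : Fin n → ℝ), IsSpectrum x n l ∧ h = -∑ i, l i * Real.log (l i)}

/-- The entropy of `x`: the infimum of `-∑ i, l i * log (l i)` over all spectra of `x`. -/
def entropy (x : A) : ℝ := sInf (spectrumEntropies x)

end JordanEntropy

end

/-!
The pure states are the primitive idempotents, and every `x ≥ 0` is a combination `∑ μᵢ cᵢ` of a
Jordan frame with eigenvalues `μᵢ ≥ 0`. If a primitive idempotent `s` satisfies `t s ≤ x`, then
`log t ≤ tr (s log x) = ∑ᵢ tr (cᵢ s) log μᵢ`: the concavity of the logarithm reduces this to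
`t tr (s x⁻¹) ≤ 1` (on the support of `x`), which follows by testing `x - t s ≥ 0` against the
square of `U_{x⁻¹} s`, where `U` is the quadratic representation. Weighting this estimate by
the coefficients of an arbitrary decomposition of `x` into pure states shows that the spectral
decomposition minimizes the entropy, so `H (x) = ∑ᵢ η (μᵢ)` with `η (t) = -t log t`.

The numbers `tr (cᵢ dₖ)` of two frames form a doubly stochastic matrix, so the concavity of `η`
gives `H (x) ≤ ∑ₖ η (tr (x dₖ))` for every frame `d`, with equality when `d` diagonalizes `x`.
Taking `d` to be the spectral frame of `(1 - t) x + t y` and using the concavity of `η` once more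
gives the concavity of `H`.

The trace is linear because, for a frame `c`, it is the sum of the coordinates of `x` along the
`cᵢ` in the Peirce decompositions. The reason is that for primitive idempotents `c` and `d` the
coordinate of `d` along `c` equals that of `c` along `d`; this is the case `a = d` of
`c (U_a c) = λ (a c)`, where `λ` is the coordinate of `a` along `c`.
-/

namespace JordanEntropy

open Polynomial

section PeirceDecomposition

variable {A : Type*} [NonUnitalNonAssocCommRing A]

theorem jordan_linearized [IsCommJordan A] [IsAddTorsionFree A] (a b c d : A) :
    a * ((b * c) * d) + b * ((c * a) * d) + c * ((a * b) * d) =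
      (b * c) * (a * d) + (c * a) * (b * d) + (a * b) * (c * d) := by
  have lie_sum : 2 • ((a * (b * c * d) - b * c * (a * d)) + (b * (c * a * d) - c * a * (b * d)) +
      (c * (a * b * d) - a * b * (c * d))) = 0 :=
    DFunLike.congr_fun (two_nsmul_lie_lmul_lmul_add_add_eq_zero a b c) d
  have sum_eq_zero := (nsmul_eq_zero_iff_right two_ne_zero).1 lie_sum
  rw [← sub_eq_zero, ← sum_eq_zero]
  abel

theorem peirce_cubic [IsCommJordan A] (K : Type*) [Field K] [CharZero K] [Module K A] {c : A}
    (hc : IsIdempotentElem c) (x : A) :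
    (2 : K) • (c * (c * (c * x))) = (3 : K) • (c * (c * x)) - c * x := by
  have : IsAddTorsionFree A := .of_isTorsionFree K A
  have jordan := jordan_linearized x c c c
  simp only [hc.eq, mul_comm x c] at jordan
  rw [mul_comm (c * x) c] at jordan
  linear_combination (norm := module) jordan

variable {K : Type*} [Field K] [Module K A] [SMulCommClass K A A]

/-- The Peirce space `A_μ(c)`: the eigenspace of multiplication by `c` for the eigenvalue `μ`. When
`c` is idempotent, `A` is the direct sum of `A_1(c)`, `A_{1/2}(c)` and `A_0(c)`. -/
def peirceSpace (c : A) (μ : K) : Submodule K A :=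
  Module.End.eigenspace (LinearMap.mulLeft K c) μ

theorem mem_peirceSpace {c x : A} {μ : K} : x ∈ peirceSpace c μ ↔ c * x = μ • x :=
  Module.End.mem_eigenspace_iff

theorem mem_peirceSpace_one {c x : A} : x ∈ peirceSpace c (1 : K) ↔ c * x = x := by
  rw [mem_peirceSpace, one_smul]

theorem mem_peirceSpace_zero {c x : A} : x ∈ peirceSpace c (0 : K) ↔ c * x = 0 := by
  rw [mem_peirceSpace, zero_smul]

variable (K) in
/-- The quadratic representation `U_a x = 2 a(ax) - a²x` of a Jordan algebra. For an idempotent `c`,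
`U_c` is the projection onto the Peirce space `A_1(c)`. -/
def quadraticRep [IsScalarTower K A A] (a : A) : A →ₗ[K] A :=
  (2 : K) • (LinearMap.mulLeft K a ∘ₗ LinearMap.mulLeft K a) - LinearMap.mulLeft K (a * a)

theorem quadraticRep_apply [IsScalarTower K A A] (a x : A) :
    quadraticRep K a x = (2 : K) • (a * (a * x)) - a * a * x := rfl

theorem quadraticRep_of_mem_peirceSpace [IsScalarTower K A A] {c x : A} {μ : K}
    (hc : IsIdempotentElem c) (hx : x ∈ peirceSpace c μ) :
    quadraticRep K c x = (2 * μ ^ 2 - μ) • x := by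
  rw [mem_peirceSpace] at hx
  rw [quadraticRep_apply, hc.eq, hx, mul_smul_comm, hx]
  module

variable [IsCommJordan A] [CharZero K] [IsScalarTower K A A]

theorem mul_left_comm_of_mem_peirceSpace {c y : A} {μ : K} (hc : IsIdempotentElem c)
    (hμ : μ ≠ 1 / 2) (hy : y ∈ peirceSpace c μ) (z : A) : c * (y * z) = y * (c * z) := by
  have : IsAddTorsionFree A := .of_isTorsionFree K A
  have jordan := jordan_linearized c c y z
  rw [mem_peirceSpace] at hy
  simp only [mul_comm y c, hy, hc.eq, smul_mul_assoc, mul_smul_comm] at jordan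
  have scaled : (2 * μ - 1) • (c * (y * z) - y * (c * z)) = 0 := by
    linear_combination (norm := module) jordan
  have hμ' : 2 * μ - 1 ≠ 0 := fun h => hμ (by linear_combination h / 2)
  exact sub_eq_zero.1 ((smul_eq_zero.1 scaled).resolve_left hμ')

theorem mul_mem_peirceSpace {c y z : A} {μ ν : K} (hc : IsIdempotentElem c) (hμ : μ ≠ 1 / 2)
    (hy : y ∈ peirceSpace c μ) (hz : z ∈ peirceSpace c ν) : y * z ∈ peirceSpace c ν := by
  rw [mem_peirceSpace, mul_left_comm_of_mem_peirceSpace hc hμ hy, mem_peirceSpace.1 hz,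
    mul_smul_comm]

theorem mul_eq_zero_of_mem_peirceSpace {c y z : A} {μ ν : K} (hc : IsIdempotentElem c)
    (hμ : μ ≠ 1 / 2) (hν : ν ≠ 1 / 2) (hμν : μ ≠ ν) (hy : y ∈ peirceSpace c μ)
    (hz : z ∈ peirceSpace c ν) : y * z = 0 := by
  have hyz := mem_peirceSpace.1 (mul_mem_peirceSpace hc hμ hy hz)
  have hzy := mem_peirceSpace.1 (mul_mem_peirceSpace hc hν hz hy)
  rw [mul_comm z y, hyz] at hzy
  by_contra hne
  exact hμν (smul_left_injective K hne hzy).symm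

theorem mul_mul_of_mem_peirceSpace_half {c u v : A} (hc : IsIdempotentElem c)
    (hu : u ∈ peirceSpace c (1 / 2 : K)) (hv : v ∈ peirceSpace c (1 / 2 : K)) :
    c * (c * (u * v)) = c * (u * v) := by
  have : IsAddTorsionFree A := .of_isTorsionFree K A
  have jordan := jordan_linearized c u v c
  rw [mem_peirceSpace] at hu hv
  simp only [mul_comm v c, mul_comm u c, hu, hv, hc.eq, smul_mul_assoc, mul_smul_comm,
    mul_comm (u * v) c, mul_comm v u] at jordan
  linear_combination (norm := module) jordan

theorem eq_zero_of_isIdempotentElem_of_mem_peirceSpace_half {c d : A} (hc : IsIdempotentElem c)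
    (hd : IsIdempotentElem d) (h : d ∈ peirceSpace c (1 / 2 : K)) : d = 0 := by
  have sq_eq := mul_mul_of_mem_peirceSpace_half hc h h
  rw [hd.eq, mem_peirceSpace.1 h, mul_smul_comm, mem_peirceSpace.1 h] at sq_eq
  have : (1 / 4 : K) • d = 0 := by linear_combination (norm := module) -sq_eq
  exact (smul_eq_zero.1 this).resolve_left (by norm_num)

variable (K) in
theorem quadraticRep_mem_peirceSpace_one {c : A} (hc : IsIdempotentElem c) (x : A) :
    quadraticRep K c x ∈ peirceSpace c (1 : K) := by
  rw [mem_peirceSpace, quadraticRep_apply, hc.eq, mul_sub, mul_smul_comm]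
  linear_combination (norm := module) peirce_cubic K hc x

variable (K) in
theorem exists_peirce_decomposition {c : A} (hc : IsIdempotentElem c) (x : A) :
    ∃ x₁ ∈ peirceSpace c (1 : K), ∃ u ∈ peirceSpace c (1 / 2 : K), ∃ x₀ ∈ peirceSpace c (0 : K),
      x = x₁ + u + x₀ := by
  have cubic := peirce_cubic K hc x
  refine ⟨quadraticRep K c x, quadraticRep_mem_peirceSpace_one K hc x,
    (4 : K) • (c * x - c * (c * x)), ?_, x - (3 : K) • (c * x) + (2 : K) • (c * (c * x)), ?_, ?_⟩
  · simp only [mem_peirceSpace, mul_sub, mul_smul_comm]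
    linear_combination (norm := module) (-2 : K) • cubic
  · simp only [mem_peirceSpace, mul_sub, mul_add, mul_smul_comm]
    linear_combination (norm := module) cubic
  · rw [quadraticRep_apply, hc.eq]
    module

end PeirceDecomposition

noncomputable section PolynomialsInOneElement

variable {A : Type*} [NonUnitalNonAssocCommRing A] {K : Type*} [Field K] [Module K A]
  [SMulCommClass K A A]

/-- The value at `x` of the polynomial `X * p`. It has no constant term, so that no unit of `A` is
needed. -/
def polyEval (x : A) : K[X] →ₗ[K] A :=
  LinearMap.applyₗ x ∘ₗ (aeval (LinearMap.mulLeft K x)).toLinearMap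

theorem polyEval_apply (x : A) (p : K[X]) : polyEval x p = aeval (LinearMap.mulLeft K x) p x := rfl

theorem polyEval_one (x : A) : polyEval x (1 : K[X]) = x := by simp [polyEval_apply]

theorem polyEval_mul (x : A) (p q : K[X]) :
    polyEval x (p * q) = aeval (LinearMap.mulLeft K x) p (polyEval x q) := by
  simp [polyEval_apply]

theorem polyEval_X_mul (x : A) (p : K[X]) : polyEval x (X * p) = x * polyEval x p := by
  simp [polyEval_mul]

theorem polyEval_C_mul (x : A) (a : K) (p : K[X]) : polyEval x (C a * p) = a • polyEval x p := by
  rw [C_mul', map_smul]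

theorem polyEval_mem_of_X_pow_mem {x : A} {V : Submodule K A}
    (hV : ∀ n, polyEval x (X ^ n : K[X]) ∈ V) (p : K[X]) : polyEval x p ∈ V := by
  induction p using Polynomial.induction_on' with
  | add p q hp hq => rw [map_add]; exact V.add_mem hp hq
  | monomial n a =>
    rw [← C_mul_X_pow_eq_monomial, polyEval_C_mul]
    exact V.smul_mem _ (hV n)

theorem polyEval_mem {x : A} {V : Submodule K A} (hx : x ∈ V) (hV : ∀ v ∈ V, x * v ∈ V)
    (p : K[X]) : polyEval x p ∈ V := by
  refine polyEval_mem_of_X_pow_mem (fun n => ?_) p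
  induction n with
  | zero => rwa [pow_zero, polyEval_one]
  | succ n ih => rw [pow_succ', polyEval_X_mul]; exact hV _ ih

variable [IsCommJordan A]

variable (K) in
theorem commute_mulLeft_mul_self (a : A) :
    Commute (LinearMap.mulLeft K a) (LinearMap.mulLeft K (a * a)) :=
  LinearMap.ext fun y => (IsJordan.lmul_lmul_comm_lmul a y).symm

variable [CharZero K]

theorem mulLeft_mul_mul (b c d : A) : LinearMap.mulLeft K ((b * c) * d) =
    LinearMap.mulLeft K (b * c) * LinearMap.mulLeft K d +
      LinearMap.mulLeft K (b * d) * LinearMap.mulLeft K c +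
      LinearMap.mulLeft K (c * d) * LinearMap.mulLeft K b -
      LinearMap.mulLeft K b * LinearMap.mulLeft K d * LinearMap.mulLeft K c -
      LinearMap.mulLeft K c * LinearMap.mulLeft K d * LinearMap.mulLeft K b := by
  ext a
  have : IsAddTorsionFree A := .of_isTorsionFree K A
  have jordan := jordan_linearized a b c d
  simp only [LinearMap.sub_apply, LinearMap.add_apply, Module.End.mul_apply,
    LinearMap.mulLeft_apply]
  rw [mul_comm (b * c * d) a, mul_comm d a, mul_comm (b * d), mul_comm (c * d), mul_comm d (c * a),
    mul_comm d (b * a), mul_comm b a]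
  linear_combination (norm := module) jordan

theorem commute_mulLeft_mul_mul {a y : A}
    (hy : Commute (LinearMap.mulLeft K a) (LinearMap.mulLeft K y))
    (hay : Commute (LinearMap.mulLeft K a) (LinearMap.mulLeft K (a * y))) :
    Commute (LinearMap.mulLeft K a) (LinearMap.mulLeft K (a * (a * y))) := by
  have ha := Commute.refl (LinearMap.mulLeft K a)
  rw [mul_comm a (a * y), mulLeft_mul_mul, mul_comm y a]
  exact ((((hay.mul_right ha).add_right ((commute_mulLeft_mul_self K a).mul_right hy)).add_right
    (hay.mul_right ha)).sub_right ((ha.mul_right ha).mul_right hy)).sub_right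
    ((hy.mul_right ha).mul_right ha)

theorem commute_mulLeft_polyEval_X_pow (x : A) (n : ℕ) :
    Commute (LinearMap.mulLeft K x) (LinearMap.mulLeft K (polyEval x (X ^ n : K[X]))) := by
  induction n using Nat.twoStepInduction with
  | zero => rw [pow_zero, polyEval_one]
  | one =>
    rw [pow_one, ← mul_one X, polyEval_X_mul, polyEval_one]
    exact commute_mulLeft_mul_self K x
  | more n hn hn' =>
    rw [pow_succ', polyEval_X_mul] at hn' ⊢
    rw [pow_succ', polyEval_X_mul]
    exact commute_mulLeft_mul_mul hn hn'

variable [IsScalarTower K A A]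

theorem commute_mulLeft_polyEval (x : A) (p : K[X]) :
    Commute (LinearMap.mulLeft K x) (LinearMap.mulLeft K (polyEval x p)) :=
  polyEval_mem_of_X_pow_mem
    (V := (Subalgebra.centralizer K {LinearMap.mulLeft K x}).toSubmodule.comap (LinearMap.mul K A))
    (fun n => Set.mem_centralizer_iff.2 fun _ h => h ▸ commute_mulLeft_polyEval_X_pow x n) p _ rfl

theorem polyEval_mul_polyEval (x : A) (p q : K[X]) :
    polyEval x p * polyEval x q = polyEval x (X * p * q) := by
  have hcomm : Commute (LinearMap.mulLeft K (polyEval x p)) (aeval (LinearMap.mulLeft K x) q) :=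
    Algebra.commute_of_mem_adjoin_singleton_of_commute (aeval_mem_adjoin_singleton K _)
      (commute_mulLeft_polyEval x p).symm
  calc polyEval x p * polyEval x q
      = aeval (LinearMap.mulLeft K x) q (polyEval x p * x) := DFunLike.congr_fun hcomm.eq x
    _ = polyEval x (q * (X * p)) := by rw [polyEval_mul, polyEval_X_mul, mul_comm x]
    _ = polyEval x (X * p * q) := by rw [mul_comm q]

theorem polyEval_mem_peirceSpace {c x : A} {μ : K} (hc : IsIdempotentElem c) (hμ : μ ≠ 1 / 2)
    (hx : x ∈ peirceSpace c μ) (p : K[X]) : polyEval x p ∈ peirceSpace c μ :=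
  polyEval_mem hx (fun _ hv => mul_mem_peirceSpace hc hμ hx hv) p

end PolynomialsInOneElement

section RealPolynomials

theorem quadratic_dvd_of_aeval_eq_zero {m : ℝ[X]} {z : ℂ} (hz : aeval z m = 0) (him : z.im ≠ 0) :
    (X - C z.re) ^ 2 + C z.im ^ 2 ∣ m := by
  convert m.quadratic_dvd_of_aeval_eq_zero_im_ne_zero hz him using 1
  rw [← Complex.normSq_eq_norm_sq, Complex.normSq_apply]
  simp only [map_mul, map_add, map_ofNat]
  ring

theorem im_eq_zero_of_aeval_eq_zero {m : ℝ[X]} (hm₀ : m ≠ 0)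
    (hm : ∀ p q : ℝ[X], m ∣ p ^ 2 + q ^ 2 → m ∣ p) {z : ℂ} (hz : aeval z m = 0) : z.im = 0 := by
  by_contra him
  obtain ⟨r, hr⟩ := quadratic_dvd_of_aeval_eq_zero hz him
  have dvd_C_mul : m ∣ C z.im * r :=
    hm _ ((X - C z.re) * r) ⟨r, by rw [hr]; ring⟩
  have dvd_r : m ∣ r := (isUnit_C.2 (Ne.isUnit him)).dvd_mul_left.1 dvd_C_mul
  have hr₀ : r ≠ 0 := by rintro rfl; exact hm₀ (by rw [hr, mul_zero])
  have degree_quadratic : ((X - C z.re) ^ 2 + C z.im ^ 2).natDegree = 2 := by compute_degree!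
  have degree_m : m.natDegree = 2 + r.natDegree := by
    rw [hr, natDegree_mul (left_ne_zero_of_mul (hr ▸ hm₀)) hr₀, degree_quadratic]
  have := natDegree_le_of_dvd dvd_r hr₀
  lia

theorem splits_of_im_eq_zero {m : ℝ[X]} (hm : ∀ z : ℂ, aeval z m = 0 → z.im = 0) : m.Splits := by
  refine Splits.of_splits_map (algebraMap ℝ ℂ) (IsAlgClosed.splits _) fun z hz =>
    ⟨z.re, Complex.ext rfl (hm z ?_).symm⟩
  rw [aeval_def, eval₂_eq_eval_map]
  exact (mem_roots'.1 hz).2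

theorem dvd_nodal_roots {F : Type*} [Field F] [PerfectField F] [DecidableEq F] {m : F[X]}
    (hsplits : m.Splits) (hsq : Squarefree m) : m ∣ Lagrange.nodal m.roots.toFinset id := by
  refine hsplits.dvd_of_roots_le_roots hsq.ne_zero ?_
  rw [Multiset.le_iff_subset (nodup_roots (PerfectField.separable_iff_squarefree.2 hsq))]
  intro a ha
  rw [mem_roots Lagrange.nodal_ne_zero]
  exact Lagrange.eval_nodal_at_node (v := id) (Multiset.mem_toFinset.2 ha)

theorem exists_nodal_mem_of_real {I : Ideal ℝ[X]} (hI : I ≠ ⊥)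
    (hreal : ∀ p q : ℝ[X], p ^ 2 + q ^ 2 ∈ I → p ∈ I) :
    ∃ s : Finset ℝ, Lagrange.nodal s id ∈ I := by
  have mem_iff (p : ℝ[X]) := Submodule.IsPrincipal.mem_iff_generator_dvd I (x := p)
  have hm₀ : Submodule.IsPrincipal.generator I ≠ 0 :=
    mt (Submodule.IsPrincipal.eq_bot_iff_generator_eq_zero I).2 hI
  simp only [mem_iff] at hreal ⊢
  have hsq : Squarefree (Submodule.IsPrincipal.generator I) := by
    refine IsRadical.squarefree hm₀ ((isRadical_iff_pow_one_lt 2 one_lt_two).2 fun p hp => ?_)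
    exact hreal p 0 (by rwa [zero_pow two_ne_zero, add_zero])
  exact ⟨_, dvd_nodal_roots (splits_of_im_eq_zero fun z =>
    im_eq_zero_of_aeval_eq_zero hm₀ hreal) hsq⟩

end RealPolynomials

section OrthogonalSystems

variable {A : Type*} {ι : Type*}

/-- A system of pairwise orthogonal idempotents, some of which may be zero. Mathlib's
`OrthogonalIdempotents` is restricted to associative rings. -/
structure IsOrthogonalSystem [Mul A] [Zero A] (e : ι → A) : Prop where
  isIdempotentElem (i : ι) : IsIdempotentElem (e i)
  mul_eq_zero {i j : ι} : i ≠ j → e i * e j = 0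

namespace IsOrthogonalSystem

variable [NonUnitalNonAssocCommRing A] [Fintype ι] {e : ι → A}

theorem mul_sum (he : IsOrthogonalSystem e) (i : ι) : e i * ∑ j, e j = e i := by
  rw [Finset.mul_sum, Finset.sum_eq_single i (fun j _ hj => he.mul_eq_zero hj.symm) (by simp),
    (he.isIdempotentElem i).eq]

theorem isIdempotentElem_sum (he : IsOrthogonalSystem e) : IsIdempotentElem (∑ i, e i) := by
  rw [IsIdempotentElem, Finset.sum_mul]
  exact Finset.sum_congr rfl fun i _ => he.mul_sum i

theorem option_elim (he : IsOrthogonalSystem e) {u : A} (hu : ∀ x, u * x = x) :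
    IsOrthogonalSystem fun o : Option ι => o.elim (u - ∑ i, e i) e := by
  have complement_mul (i : ι) : (u - ∑ i, e i) * e i = 0 := by
    rw [sub_mul, hu, mul_comm, he.mul_sum, sub_self]
  refine ⟨?_, ?_⟩
  · rintro (_ | i)
    · simp only [IsIdempotentElem, Option.elim_none, mul_sub, mul_comm _ u, hu,
        mul_comm _ (∑ i, e i), he.isIdempotentElem_sum.eq, sub_self, sub_zero]
    · exact he.isIdempotentElem i
  · rintro (_ | i) (_ | j) hij
    · exact absurd rfl hij
    · exact complement_mul j
    · exact (mul_comm _ _).trans (complement_mul i)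
    · exact he.mul_eq_zero fun h => hij (congrArg some h)

theorem sum_smul_mul {K : Type*} [Semiring K] [Module K A] [IsScalarTower K A A]
    (he : IsOrthogonalSystem e) (l : ι → K) (i : ι) : (∑ j, l j • e j) * e i = l i • e i := by
  rw [Finset.sum_mul, Finset.sum_eq_single i (fun j _ hj => by
    rw [smul_mul_assoc, he.mul_eq_zero hj, smul_zero]) (by simp), smul_mul_assoc,
    (he.isIdempotentElem i).eq]

theorem sum_smul_mul_sum_smul {K : Type*} [CommSemiring K] [Module K A] [IsScalarTower K A A]
    [SMulCommClass K A A] (he : IsOrthogonalSystem e) (l m : ι → K) :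
    (∑ i, l i • e i) * ∑ i, m i • e i = ∑ i, (l i * m i) • e i := by
  rw [Finset.mul_sum]
  exact Finset.sum_congr rfl fun i _ => by
    rw [mul_smul_comm, he.sum_smul_mul, smul_smul, mul_comm]

end IsOrthogonalSystem

end OrthogonalSystems

noncomputable section SpectralResolution

variable {A : Type*} [NonUnitalNonAssocCommRing A] {K : Type*} [Field K] [Module K A]
  [SMulCommClass K A A]

variable (K) in
/-- The ideal of the polynomials `p` such that `X * p` vanishes at `x`. -/
def polyAnnihilator (x : A) : Ideal K[X] where
  __ := (LinearMap.ker (polyEval x : K[X] →ₗ[K] A)).toAddSubmonoid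
  smul_mem' p q hq := by
    change polyEval x (p * q) = 0
    rw [polyEval_mul, LinearMap.mem_ker.1 hq, map_zero]

theorem mem_polyAnnihilator {x : A} {p : K[X]} : p ∈ polyAnnihilator K x ↔ polyEval x p = 0 :=
  Iff.rfl

theorem polyAnnihilator_ne_bot [FiniteDimensional K A] (x : A) : polyAnnihilator K x ≠ ⊥ := by
  refine (Submodule.ne_bot_iff _).2 ⟨minpoly K (LinearMap.mulLeft K x), ?_,
    minpoly.ne_zero (Algebra.IsIntegral.isIntegral _)⟩
  rw [mem_polyAnnihilator, polyEval_apply, minpoly.aeval, LinearMap.zero_apply]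

theorem polyEval_eq_of_eval_eq {x : A} {s : Finset K}
    (hs : Lagrange.nodal s id ∈ polyAnnihilator K x) {p q : K[X]}
    (hpq : ∀ a ∈ s, p.eval a = q.eval a) : polyEval x p = polyEval x q := by
  have nodal_dvd : Lagrange.nodal s id ∣ p - q := by
    refine Finset.prod_dvd_of_coprime
      (fun a _ b _ hab => pairwise_coprime_X_sub_C Function.injective_id hab) fun a ha => ?_
    rw [id_eq, dvd_iff_isRoot, IsRoot, eval_sub, hpq a ha, sub_self]
  rw [← sub_eq_zero, ← map_sub]
  exact mem_polyAnnihilator.1 (Ideal.mem_of_dvd _ nodal_dvd hs)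

/-- The idempotent of `x` that belongs to the eigenvalue `a`, where `s` is the set of the nonzero
eigenvalues: the value at `x` of the polynomial without constant term that is `1` at `a` and `0` at
the other elements of `s`. -/
def spectralIdempotent [DecidableEq K] (x : A) (s : Finset K) (a : K) : A :=
  polyEval x (C a⁻¹ * Lagrange.basis s id a)

theorem sum_smul_spectralIdempotent [DecidableEq K] {x : A} {s : Finset K}
    (hs : Lagrange.nodal s id ∈ polyAnnihilator K x) (hs₀ : 0 ∉ s) :
    ∑ a : s, (a : K) • spectralIdempotent x s a = x := by
  have polyEval_sum : ∑ a : s, (a : K) • spectralIdempotent x s a =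
      polyEval x (∑ a ∈ s, Lagrange.basis s id a) := by
    rw [Finset.sum_coe_sort s fun a => a • spectralIdempotent x s a, map_sum]
    refine Finset.sum_congr rfl fun a ha => ?_
    rw [spectralIdempotent, polyEval_C_mul, smul_inv_smul₀ (ne_of_mem_of_not_mem ha hs₀)]
  rw [polyEval_sum, polyEval_eq_of_eval_eq hs (q := 1) fun a ha => ?_, polyEval_one]
  rw [Lagrange.sum_basis Function.injective_id.injOn ⟨a, ha⟩]

variable [IsScalarTower K A A] [CharZero K] [IsCommJordan A]

theorem isOrthogonalSystem_spectralIdempotent [DecidableEq K] {x : A} {s : Finset K}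
    (hs : Lagrange.nodal s id ∈ polyAnnihilator K x) (hs₀ : 0 ∉ s) :
    IsOrthogonalSystem fun a : s => spectralIdempotent x s a := by
  have eval_self {a : K} (ha : a ∈ s) : (Lagrange.basis s id a).eval a = 1 :=
    Lagrange.eval_basis_self (v := id) Function.injective_id.injOn ha
  have eval_of_ne {a b : K} (hb : b ∈ s) (hab : a ≠ b) : (Lagrange.basis s id a).eval b = 0 :=
    Lagrange.eval_basis_of_ne (v := id) hab hb
  refine ⟨fun a => ?_, fun {a b} hab => ?_⟩ <;>
    simp only [IsIdempotentElem, spectralIdempotent, polyEval_mul_polyEval]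
  · refine polyEval_eq_of_eval_eq hs fun b hb => ?_
    rcases eq_or_ne (a : K) b with rfl | hab
    · simp [eval_self hb, ne_of_mem_of_not_mem hb hs₀]
    · simp [eval_of_ne hb hab]
  · rw [polyEval_eq_of_eval_eq hs (q := 0) fun d hd => ?_, map_zero]
    rcases eq_or_ne (a : K) d with rfl | had
    · simp [eval_of_ne hd (Subtype.coe_ne_coe.2 hab.symm)]
    · simp [eval_of_ne hd had]

end SpectralResolution

section FormallyReal

variable {A : Type*} [NonUnitalNonAssocCommRing A] [IsFormallyReal A]

theorem eq_zero_of_mul_self_eq_zero {x : A} (h : x * x = 0) : x = 0 := by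
  by_contra hx
  exact IsFormallyReal.not_isSumNonzeroSq_zero (h ▸ IsSumNonzeroSq.sq hx)

theorem eq_zero_of_mul_self_add_mul_self_eq_zero {x y : A} (h : x * x + y * y = 0) : x = 0 :=
  eq_zero_of_mul_self_eq_zero
    (IsFormallyReal.eq_zero_of_add_right (IsSumSq.mul_self x) (IsSumSq.mul_self y) h)

variable {K : Type*} [Field K] [CharZero K] [Module K A] [IsScalarTower K A A] [SMulCommClass K A A]
  [IsCommJordan A]

theorem mem_polyAnnihilator_of_sq_add_sq_mem {x : A} {p q : K[X]}
    (h : p ^ 2 + q ^ 2 ∈ polyAnnihilator K x) : p ∈ polyAnnihilator K x := by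
  refine eq_zero_of_mul_self_add_mul_self_eq_zero (y := polyEval x q) ?_
  rw [polyEval_mul_polyEval, polyEval_mul_polyEval, ← map_add, ← mem_polyAnnihilator,
    show X * p * p + X * q * q = X * (p ^ 2 + q ^ 2) by ring]
  exact Ideal.mul_mem_left _ _ h

theorem mem_polyAnnihilator_of_X_mul_mem {x : A} {p : K[X]}
    (h : X * p ∈ polyAnnihilator K x) : p ∈ polyAnnihilator K x := by
  refine eq_zero_of_mul_self_eq_zero ?_
  rw [polyEval_mul_polyEval, ← mem_polyAnnihilator]
  exact Ideal.mul_mem_right _ _ h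

end FormallyReal

section RealSpectralResolution

variable {A : Type*} [NonUnitalNonAssocCommRing A] [IsFormallyReal A] [IsCommJordan A]
  [Module ℝ A] [IsScalarTower ℝ A A] [SMulCommClass ℝ A A] [FiniteDimensional ℝ A]

theorem exists_nodal_mem_polyAnnihilator (x : A) :
    ∃ s : Finset ℝ, 0 ∉ s ∧ Lagrange.nodal s id ∈ polyAnnihilator ℝ x := by
  obtain ⟨s, hs⟩ := exists_nodal_mem_of_real (polyAnnihilator_ne_bot x)
    fun _ _ => mem_polyAnnihilator_of_sq_add_sq_mem
  by_cases hs₀ : (0 : ℝ) ∈ s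
  · refine ⟨s.erase 0, Finset.notMem_erase 0 s, mem_polyAnnihilator_of_X_mul_mem ?_⟩
    rwa [Lagrange.nodal_eq_mul_nodal_erase hs₀, id_eq, C_0, sub_zero] at hs
  · exact ⟨s, hs₀, hs⟩

theorem exists_spectral_resolution (x : A) :
    ∃ (s : Finset ℝ) (e : s → A), IsOrthogonalSystem e ∧ x = ∑ a : s, (a : ℝ) • e a ∧
      ∀ a, e a ∈ Set.range (polyEval x : ℝ[X] →ₗ[ℝ] A) := by
  obtain ⟨s, hs₀, hs⟩ := exists_nodal_mem_polyAnnihilator x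
  exact ⟨s, fun a => spectralIdempotent x s a, isOrthogonalSystem_spectralIdempotent hs hs₀,
    (sum_smul_spectralIdempotent hs hs₀).symm, fun a => ⟨_, rfl⟩⟩

end RealSpectralResolution

section OrthogonalIdempotents

variable {A : Type*} [NonUnitalNonAssocCommRing A] [IsCommJordan A] {K : Type*} [Field K]
  [CharZero K] [Module K A] [IsScalarTower K A A] [SMulCommClass K A A]

theorem mul_eq_zero_of_orthogonal {a b x y : A} (ha : IsIdempotentElem a)
    (hb : IsIdempotentElem b) (hab : a * b = 0) (hx : x ∈ peirceSpace a (1 : K))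
    (hy : y ∈ peirceSpace b (1 : K)) : x * y = 0 := by
  have half_ne_one : (1 : K) ≠ 1 / 2 := by norm_num
  have half_ne_zero : (0 : K) ≠ 1 / 2 := by norm_num
  have hay : a * y = 0 := mul_eq_zero_of_mem_peirceSpace hb half_ne_zero half_ne_one zero_ne_one
    (mem_peirceSpace_zero.2 (by rw [mul_comm, hab])) hy
  exact mul_eq_zero_of_mem_peirceSpace ha half_ne_one half_ne_zero one_ne_zero hx
    (mem_peirceSpace_zero.2 hay)

variable (K) in
theorem peirceSpace_one_lt_add {a b : A} (ha : IsIdempotentElem a) (hb : IsIdempotentElem b)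
    (hab : a * b = 0) (hb₀ : b ≠ 0) : peirceSpace a (1 : K) < peirceSpace (a + b) (1 : K) := by
  refine SetLike.lt_iff_le_and_exists.2 ⟨fun x hx => ?_, b, ?_, ?_⟩
  · have hbx : b * x = 0 := by
      rw [mul_comm]
      exact mul_eq_zero_of_orthogonal ha hb hab hx (mem_peirceSpace_one.2 hb.eq)
    rw [mem_peirceSpace_one] at hx ⊢
    rw [add_mul, hx, hbx, add_zero]
  · rw [mem_peirceSpace_one, add_mul, hab, hb.eq, zero_add]
  · rw [mem_peirceSpace_one, hab]
    exact hb₀.symm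

end OrthogonalIdempotents

section Unit

variable {A : Type*} [NonUnitalNonAssocCommRing A] [IsCommJordan A] [IsFormallyReal A]

theorem eq_zero_of_mem_peirceSpace_half {K : Type*} [Field K] [CharZero K] [Module K A]
    [IsScalarTower K A A] [SMulCommClass K A A] {e u : A} (he : IsIdempotentElem e)
    (he₀ : peirceSpace e (0 : K) = ⊥) (hu : u ∈ peirceSpace e (1 / 2 : K)) : u = 0 := by
  have mul_sq : e * (u * u) = u * u := by
    have mem_zero : u * u - e * (u * u) ∈ peirceSpace e (0 : K) := by
      rw [mem_peirceSpace_zero, mul_sub, mul_mul_of_mem_peirceSpace_half he hu hu, sub_self]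
    rw [he₀, Submodule.mem_bot, sub_eq_zero] at mem_zero
    exact mem_zero.symm
  have cube_eq_zero : u * (u * u) = 0 := by
    have jordan := IsCommJordan.lmul_comm_rmul_rmul u e
    rw [mul_sq, mul_comm u e, mem_peirceSpace.1 hu, smul_mul_assoc] at jordan
    have : (1 / 2 : K) • (u * (u * u)) = 0 := by linear_combination (norm := module) -jordan
    exact (smul_eq_zero.1 this).resolve_left (by norm_num)
  refine eq_zero_of_mul_self_eq_zero (eq_zero_of_mul_self_eq_zero ?_)
  rw [IsCommJordan.lmul_comm_rmul_rmul, cube_eq_zero, mul_zero]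

variable [Module ℝ A] [IsScalarTower ℝ A A] [SMulCommClass ℝ A A] [FiniteDimensional ℝ A]

theorem eq_zero_of_forall_idempotent_eq_zero {c x : A} (hc : IsIdempotentElem c)
    (hx : x ∈ peirceSpace c (0 : ℝ))
    (h : ∀ f ∈ peirceSpace c (0 : ℝ), IsIdempotentElem f → f = 0) : x = 0 := by
  obtain ⟨s, e, he, hxe, hpoly⟩ := exists_spectral_resolution x
  rw [hxe]
  refine Finset.sum_eq_zero fun a _ => ?_
  obtain ⟨p, hp⟩ := hpoly a
  rw [h (e a) (hp ▸ polyEval_mem_peirceSpace hc (by norm_num) hx p) (he.isIdempotentElem a),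
    smul_zero]

variable (A) in
theorem exists_isIdempotentElem_peirceSpace_zero_eq_bot :
    ∃ e : A, IsIdempotentElem e ∧ peirceSpace e (0 : ℝ) = ⊥ := by
  obtain ⟨-, ⟨e, he, rfl⟩, maximal⟩ := WellFounded.has_min (wellFounded_gt (α := Submodule ℝ A))
    ((peirceSpace · (1 : ℝ)) '' {e : A | IsIdempotentElem e}) ⟨_, 0, IsIdempotentElem.zero, rfl⟩
  refine ⟨e, he, (Submodule.eq_bot_iff _).2 fun x hx =>
    eq_zero_of_forall_idempotent_eq_zero he hx fun f hf hff => ?_⟩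
  by_contra hf₀
  rw [mem_peirceSpace_zero] at hf
  have add_idem : IsIdempotentElem (e + f) := by
    rw [IsIdempotentElem, add_mul, mul_add, mul_add, mul_comm f e, hf, he.eq, hff.eq, add_zero,
      zero_add]
  exact maximal _ ⟨_, add_idem, rfl⟩ (peirceSpace_one_lt_add ℝ he hff hf hf₀)

variable (A) in
theorem exists_unit : ∃ e : A, ∀ x, e * x = x := by
  obtain ⟨e, he, he₀⟩ := exists_isIdempotentElem_peirceSpace_zero_eq_bot A
  refine ⟨e, fun x => ?_⟩
  obtain ⟨x₁, hx₁, u, hu, x₀, hx₀, rfl⟩ := exists_peirce_decomposition ℝ he x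
  rw [eq_zero_of_mem_peirceSpace_half he he₀ hu, (Submodule.eq_bot_iff _).1 he₀ x₀ hx₀, add_zero,
    add_zero, mem_peirceSpace_one.1 hx₁]

end Unit

section Frames

variable {A : Type*} [NonUnitalNonAssocCommRing A]

/-- A Jordan frame: a system of pairwise orthogonal primitive idempotents whose sum is a unit
element. -/
structure IsFrame {ι : Type*} [Fintype ι] (c : ι → A) : Prop extends IsOrthogonalSystem c where
  isPrimitive (i : ι) : IsPrimitiveIdempotent (c i)
  sum_mul (x : A) : (∑ i, c i) * x = x

theorem IsFrame.comp_equiv {ι κ : Type*} [Fintype ι] [Fintype κ] {c : ι → A} (hc : IsFrame c)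
    (f : κ ≃ ι) : IsFrame (c ∘ f) where
  isIdempotentElem k := hc.isIdempotentElem (f k)
  mul_eq_zero h := hc.mul_eq_zero (f.injective.ne h)
  isPrimitive k := hc.isPrimitive (f k)
  sum_mul x := by simp only [Function.comp_apply, f.sum_comp, hc.sum_mul]

theorem isOrthogonalSystem_pair {a b : A} (ha : IsIdempotentElem a) (hb : IsIdempotentElem b)
    (hab : a * b = 0) : IsOrthogonalSystem ![a, b] := by
  refine ⟨Fin.forall_fin_two.2 ⟨ha, hb⟩, fun {i j} hij => ?_⟩
  fin_cases i <;> fin_cases j <;> simp_all [mul_comm b a]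

variable (K : Type*) [Field K] [CharZero K] [Module K A] [IsScalarTower K A A]
  [SMulCommClass K A A] [IsCommJordan A]

include K in
theorem IsOrthogonalSystem.sigma {ι : Type*} {κ : ι → Type*} [∀ i, Fintype (κ i)] {e : ι → A}
    (he : IsOrthogonalSystem e) {d : ∀ i, κ i → A} (hd : ∀ i, IsOrthogonalSystem (d i))
    (hsum : ∀ i, ∑ k, d i k = e i) : IsOrthogonalSystem fun p : Σ i, κ i => d p.1 p.2 := by
  have component_mem (i : ι) (k : κ i) : d i k ∈ peirceSpace (e i) (1 : K) := by
    rw [mem_peirceSpace_one, mul_comm, ← hsum, (hd i).mul_sum]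
  refine ⟨fun p => (hd p.1).isIdempotentElem p.2, ?_⟩
  rintro ⟨i, k⟩ ⟨j, l⟩ hne
  rcases eq_or_ne i j with rfl | hij
  · exact (hd i).mul_eq_zero fun h => hne (congrArg (Sigma.mk i) h)
  · exact mul_eq_zero_of_orthogonal (he.isIdempotentElem i) (he.isIdempotentElem j)
      (he.mul_eq_zero hij) (component_mem i k) (component_mem j l)

/-- `e` is the sum of a finite system of orthogonal primitive idempotents. Index types are taken in
`Type`, which suffices for finite systems. -/
def HasPrimitiveDecomposition (e : A) : Prop :=
  ∃ (κ : Type) (_ : Fintype κ) (d : κ → A), IsOrthogonalSystem d ∧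
    (∀ k, IsPrimitiveIdempotent (d k)) ∧ ∑ k, d k = e

theorem exists_primitive_refinement {ι : Type} [Fintype ι] {e : ι → A} (he : IsOrthogonalSystem e)
    (h : ∀ i, HasPrimitiveDecomposition (e i)) :
    ∃ (κ : Type) (_ : Fintype κ) (d : κ → A) (f : κ → ι), IsOrthogonalSystem d ∧
      (∀ k, IsPrimitiveIdempotent (d k)) ∧
      ∀ l : ι → K, ∑ k, l (f k) • d k = ∑ i, l i • e i := by
  choose κ _ d hd hprim hsum using h
  refine ⟨Σ i, κ i, inferInstance, fun p => d p.1 p.2, Sigma.fst, he.sigma K hd hsum,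
    fun p => hprim p.1 p.2, fun l => ?_⟩
  simp only [Fintype.sum_sigma, ← Finset.smul_sum, hsum]

variable [FiniteDimensional K A]

include K in
theorem hasPrimitiveDecomposition_of_isIdempotentElem {c : A} (hc : IsIdempotentElem c) :
    HasPrimitiveDecomposition c := by
  induction c using (InvImage.wf (peirceSpace (A := A) · (1 : K)) wellFounded_lt).induction with
  | h c ih
  by_cases hc₀ : c = 0
  · exact ⟨Empty, inferInstance, Empty.elim, ⟨nofun, nofun⟩, nofun, by simp [hc₀]⟩
  by_cases hprim : IsPrimitiveIdempotent c
  · refine ⟨Unit, inferInstance, fun _ => c, ⟨fun _ => hc, fun h => (h rfl).elim⟩,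
      fun _ => hprim, by simp⟩
  simp only [IsPrimitiveIdempotent, not_and, not_forall, not_or] at hprim
  obtain ⟨a, b, ha, hb, hab, rfl, ha₀, hb₀⟩ := hprim hc₀ hc
  have decomposition (i : Fin 2) : HasPrimitiveDecomposition (![a, b] i) := by
    fin_cases i
    · exact ih a (peirceSpace_one_lt_add K ha hb hab hb₀) ha
    · refine ih b ?_ hb
      rw [InvImage, add_comm]
      exact peirceSpace_one_lt_add K hb ha (by rw [mul_comm, hab]) ha₀
  obtain ⟨κ, _, d, _, hd, hprim, hsum⟩ := exists_primitive_refinement K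
    (isOrthogonalSystem_pair ha hb hab) decomposition
  exact ⟨κ, _, d, hd, hprim, by simpa using hsum 1⟩

theorem exists_spectral_frame [IsFormallyReal A] [Module ℝ A] [IsScalarTower ℝ A A]
    [SMulCommClass ℝ A A] [FiniteDimensional ℝ A] (x : A) :
    ∃ (n : ℕ) (c : Fin n → A) (l : Fin n → ℝ), IsFrame c ∧ x = ∑ i, l i • c i := by
  obtain ⟨s, e, he, hx, -⟩ := exists_spectral_resolution x
  obtain ⟨u, hu⟩ := exists_unit A
  have he' := he.option_elim hu
  obtain ⟨κ, _, d, f, hd, hprim, hsum⟩ := exists_primitive_refinement ℝ he'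
    fun o => hasPrimitiveDecomposition_of_isIdempotentElem ℝ (he'.isIdempotentElem o)
  have frame : IsFrame d := ⟨hd, hprim, fun y => by simpa [hu] using congrArg (· * y) (hsum 1)⟩
  let n := Fintype.equivFin κ
  refine ⟨_, d ∘ n.symm, (fun k => (f k).elim 0 (↑)) ∘ n.symm, frame.comp_equiv n.symm, ?_⟩
  calc x = ∑ k, ((f k).elim 0 (↑) : ℝ) • d k := by rw [hsum fun o => o.elim 0 (↑)]; simp [hx]
    _ = _ := (n.symm.sum_comp _).symm

end Frames

noncomputable section PrimitiveIdempotents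

variable {A : Type*} [NonUnitalNonAssocCommRing A] {c d : A}

theorem IsPrimitiveIdempotent.eq_zero_or_eq {f : A} (hc : IsPrimitiveIdempotent c)
    (hf : IsIdempotentElem f) (hcf : c * f = f) : f = 0 ∨ f = c := by
  have orthogonal : f * (c - f) = 0 := by rw [mul_sub, mul_comm, hcf, hf.eq, sub_self]
  have complement : IsIdempotentElem (c - f) := by
    rw [IsIdempotentElem, sub_mul _ _ (c - f), orthogonal, mul_sub, hc.2.1.eq, hcf, sub_zero]
  exact (hc.2.2 f (c - f) hf complement orthogonal (add_sub_cancel f c)).imp_right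
    fun h => (sub_eq_zero.1 h).symm

variable [Module ℝ A] [IsScalarTower ℝ A A] [SMulCommClass ℝ A A] [IsCommJordan A]
  [IsFormallyReal A] [FiniteDimensional ℝ A]

theorem peirceSpace_one_le_span (hc : IsPrimitiveIdempotent c) :
    peirceSpace c (1 : ℝ) ≤ Submodule.span ℝ {c} := by
  intro x hx
  obtain ⟨s, e, he, hxe, hpoly⟩ := exists_spectral_resolution x
  rw [hxe]
  refine Submodule.sum_smul_mem _ _ fun a _ => ?_
  obtain ⟨p, hp⟩ := hpoly a
  have he_mem : e a ∈ peirceSpace c (1 : ℝ) :=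
    hp ▸ polyEval_mem_peirceSpace hc.2.1 (by norm_num) hx p
  rcases hc.eq_zero_or_eq (he.isIdempotentElem a) (mem_peirceSpace_one.1 he_mem) with h | h
  · rw [h]
    exact zero_mem _
  · rw [h]
    exact Submodule.mem_span_singleton_self c

/-- The coordinate of `x` along a primitive idempotent `c` in the Peirce decomposition of `A` with
respect to `c`, whose component of eigenvalue one is the line through `c`. -/
def peirceCoeff (hc : IsPrimitiveIdempotent c) : A →ₗ[ℝ] ℝ :=
  (LinearEquiv.toSpanNonzeroSingleton ℝ A c hc.1).symm ∘ₗ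
    (quadraticRep ℝ c).codRestrict _ fun x =>
      peirceSpace_one_le_span hc (quadraticRep_mem_peirceSpace_one ℝ hc.2.1 x)

theorem peirceCoeff_smul (hc : IsPrimitiveIdempotent c) (x : A) :
    peirceCoeff hc x • c = quadraticRep ℝ c x :=
  LinearEquiv.coord_apply_smul ℝ A c hc.1 ⟨quadraticRep ℝ c x, _⟩

theorem exists_peirce_decomposition_of_isPrimitive (hc : IsPrimitiveIdempotent c) (x : A) :
    ∃ u ∈ peirceSpace c (1 / 2 : ℝ), ∃ v ∈ peirceSpace c (0 : ℝ),
      x = peirceCoeff hc x • c + u + v := by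
  obtain ⟨x₁, hx₁, u, hu, v, hv, rfl⟩ := exists_peirce_decomposition ℝ hc.2.1 x
  refine ⟨u, hu, v, hv, ?_⟩
  rw [peirceCoeff_smul, map_add, map_add, quadraticRep_of_mem_peirceSpace hc.2.1 hx₁,
    quadraticRep_of_mem_peirceSpace hc.2.1 hu, quadraticRep_of_mem_peirceSpace hc.2.1 hv]
  module

theorem mul_quadraticRep_self (hc : IsPrimitiveIdempotent c) (a : A) :
    c * quadraticRep ℝ a c = peirceCoeff hc a • (a * c) := by
  obtain ⟨u, hu, v, hv, ha⟩ := exists_peirce_decomposition_of_isPrimitive hc a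
  have mul_sq := mul_mul_of_mem_peirceSpace_half hc.2.1 hu hu
  have huv : c * (u * v) = (1 / 2 : ℝ) • (u * v) := by
    rw [mul_comm u v]
    exact mem_peirceSpace.1 (mul_mem_peirceSpace hc.2.1 (by norm_num) hv hu)
  have hvv : c * (v * v) = 0 :=
    mem_peirceSpace_zero.1 (mul_mem_peirceSpace hc.2.1 (by norm_num) hv hv)
  rw [mem_peirceSpace] at hu
  rw [mem_peirceSpace_zero] at hv
  have hcu : u * c = (1 / 2 : ℝ) • u := by rw [mul_comm, hu]
  have hcv : v * c = 0 := by rw [mul_comm, hv]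
  generalize peirceCoeff hc a = k at ha ⊢
  rw [quadraticRep_apply, mul_comm (a * a) c, ha]
  simp only [add_mul, mul_add, mul_sub, smul_mul_assoc, mul_smul_comm, hc.2.1.eq, hu, hv, hcu,
    hcv, mul_comm v u, huv, hvv, mul_sq, mul_zero, smul_zero]
  module

theorem peirceCoeff_comm (hc : IsPrimitiveIdempotent c) (hd : IsPrimitiveIdempotent d) :
    peirceCoeff hc d = peirceCoeff hd c := by
  have proportional := mul_quadraticRep_self hc d
  rw [← peirceCoeff_smul hd, mul_smul_comm, mul_comm, ← sub_eq_zero, ← sub_smul,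
    smul_eq_zero, sub_eq_zero] at proportional
  rcases proportional with h | h
  · exact h.symm
  · have hcd : peirceCoeff hc d • c = 0 := by
      rw [peirceCoeff_smul, quadraticRep_apply, hc.2.1.eq, mul_comm c d, h, mul_zero, smul_zero,
        sub_zero]
    have hdc : peirceCoeff hd c • d = 0 := by
      rw [peirceCoeff_smul, quadraticRep_apply, hd.2.1.eq, h, mul_zero, smul_zero, sub_zero]
    rw [(smul_eq_zero.1 hcd).resolve_right hc.1, (smul_eq_zero.1 hdc).resolve_right hd.1]

theorem peirceCoeff_eq_zero {e u : A} {μ ν : ℝ} (he : IsIdempotentElem e)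
    (hd : IsPrimitiveIdempotent d) (hde : d ∈ peirceSpace e μ) (hμ : μ ≠ 1 / 2)
    (hu : u ∈ peirceSpace e ν) (hμν : μ ≠ ν) : peirceCoeff hd u = 0 := by
  have mem_left : peirceCoeff hd u • d ∈ peirceSpace e μ := Submodule.smul_mem _ _ hde
  have mem_right : peirceCoeff hd u • d ∈ peirceSpace e ν := by
    have hdu := mul_mem_peirceSpace he hμ hde hu
    rw [peirceCoeff_smul, quadraticRep_apply, hd.2.1.eq]
    exact sub_mem (Submodule.smul_mem _ _ (mul_mem_peirceSpace he hμ hde hdu)) hdu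
  rw [mem_peirceSpace] at mem_left mem_right
  rw [mem_left, ← sub_eq_zero, ← sub_smul, smul_smul, smul_eq_zero, mul_eq_zero] at mem_right
  exact (mem_right.resolve_right hd.1).resolve_left (sub_ne_zero.2 hμν)

end PrimitiveIdempotents

section Trace

variable {A : Type*} [NonUnitalNonAssocCommRing A] [Module ℝ A] [IsScalarTower ℝ A A]
  [SMulCommClass ℝ A A] [IsCommJordan A] [IsFormallyReal A] [FiniteDimensional ℝ A] {c d : A}

theorem peirceCoeff_eq_one {e : A} (hd : IsPrimitiveIdempotent d) (hde : d * e = d) :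
    peirceCoeff hd e = 1 := by
  refine smul_left_injective ℝ hd.1 ?_
  dsimp only
  rw [peirceCoeff_smul, quadraticRep_apply, hd.2.1.eq, hde, hd.2.1.eq]
  module

namespace IsFrame

variable {ι : Type*} [Fintype ι] {c : ι → A}

theorem sum_peirceCoeff (hc : IsFrame c) (hd : IsPrimitiveIdempotent d) :
    ∑ i, peirceCoeff (hc.isPrimitive i) d = 1 := by
  simp only [peirceCoeff_comm _ hd, ← map_sum]
  exact peirceCoeff_eq_one hd (by rw [mul_comm, hc.sum_mul])

theorem trace_eq (hc : IsFrame c) (x : A) :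
    trace x = ∑ i, peirceCoeff (hc.isPrimitive i) x := by
  have exists_trace : ∃ t : ℝ, ∃ (n : ℕ) (d : Fin n → A) (l : Fin n → ℝ),
      IsSpectralDecomposition x n d l ∧ t = ∑ j, l j := by
    obtain ⟨n, d, l, hd, hx⟩ := exists_spectral_frame x
    exact ⟨_, n, d, l, ⟨hd.isPrimitive, fun _ _ => hd.mul_eq_zero, hx⟩, rfl⟩
  rw [trace, dif_pos exists_trace]
  obtain ⟨n, d, l, ⟨hd, -, hx⟩, ht⟩ := exists_trace.choose_spec
  rw [ht]
  calc ∑ j, l j = ∑ j, l j * ∑ i, peirceCoeff (hc.isPrimitive i) (d j) := by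
        simp only [hc.sum_peirceCoeff (hd _), mul_one]
    _ = ∑ i, ∑ j, l j * peirceCoeff (hc.isPrimitive i) (d j) := by
        simp only [Finset.mul_sum]
        exact Finset.sum_comm
    _ = ∑ i, peirceCoeff (hc.isPrimitive i) x := by
        conv_rhs => rw [hx]
        simp only [map_sum, map_smul, smul_eq_mul]

end IsFrame

variable (A) in
theorem isLinearMap_trace : IsLinearMap ℝ (trace : A → ℝ) := by
  obtain ⟨n, c, -, hc, -⟩ := exists_spectral_frame (0 : A)
  refine ⟨fun x y => ?_, fun a x => ?_⟩
  · simp only [hc.trace_eq, map_add, Finset.sum_add_distrib]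
  · simp only [hc.trace_eq, map_smul, Finset.smul_sum]

theorem trace_add (x y : A) : trace (x + y) = trace x + trace y :=
  (isLinearMap_trace A).map_add x y

theorem trace_sub (x y : A) : trace (x - y) = trace x - trace y :=
  (isLinearMap_trace A).map_sub x y

theorem trace_smul (a : ℝ) (x : A) : trace (a • x) = a * trace x :=
  (isLinearMap_trace A).map_smul a x

theorem trace_zero : trace (0 : A) = 0 := (isLinearMap_trace A).map_zero

theorem trace_sum {ι : Type*} (s : Finset ι) (x : ι → A) :
    trace (∑ i ∈ s, x i) = ∑ i ∈ s, trace (x i) :=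
  map_sum (isLinearMap_trace A).mk' x s

theorem trace_of_isPrimitive (hc : IsPrimitiveIdempotent c) : trace c = 1 := by
  obtain ⟨n, d, -, hd, -⟩ := exists_spectral_frame (0 : A)
  rw [hd.trace_eq, hd.sum_peirceCoeff hc]

theorem trace_sum_smul {ι : Type*} [Fintype ι] {c : ι → A} (hc : ∀ i, IsPrimitiveIdempotent (c i))
    (l : ι → ℝ) : trace (∑ i, l i • c i) = ∑ i, l i := by
  simp only [trace_sum, trace_smul, trace_of_isPrimitive (hc _), mul_one]

theorem trace_eq_zero_of_mem_peirceSpace_half (hc : IsIdempotentElem c) {u : A}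
    (hu : u ∈ peirceSpace c (1 / 2 : ℝ)) : trace u = 0 := by
  obtain ⟨n, d, l, hd, hcd⟩ := exists_spectral_frame c
  rw [hd.trace_eq]
  refine Finset.sum_eq_zero fun i _ => ?_
  have hdi : d i ∈ peirceSpace c (l i) := by rw [mem_peirceSpace, hcd, hd.sum_smul_mul]
  have ne_half : l i ≠ 1 / 2 := fun h => by
    rw [h] at hdi
    exact (hd.isPrimitive i).1
      (eq_zero_of_isIdempotentElem_of_mem_peirceSpace_half hc (hd.isIdempotentElem i) hdi)
  exact peirceCoeff_eq_zero hc (hd.isPrimitive i) hdi ne_half hu ne_half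

theorem trace_mul_eq_zero_of_mem_peirceSpace (hc : IsIdempotentElem c) {μ ν : ℝ} (hμν : μ ≠ ν)
    {x z : A} (hx : x ∈ peirceSpace c μ) (hz : z ∈ peirceSpace c ν) : trace (x * z) = 0 := by
  by_cases hμ : μ = 1 / 2
  · subst hμ
    rw [mul_comm]
    exact trace_eq_zero_of_mem_peirceSpace_half hc (mul_mem_peirceSpace hc hμν.symm hz hx)
  · by_cases hν : ν = 1 / 2
    · subst hν
      exact trace_eq_zero_of_mem_peirceSpace_half hc (mul_mem_peirceSpace hc hμ hx hz)
    · rw [mul_eq_zero_of_mem_peirceSpace hc hμ hν hμν hx hz, trace_zero]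

theorem trace_mul_assoc_of_isIdempotentElem (hc : IsIdempotentElem c) (x z : A) :
    trace (x * c * z) = trace (x * (c * z)) := by
  have homogeneous {μ ν : ℝ} {x z : A} (hx : x ∈ peirceSpace c μ) (hz : z ∈ peirceSpace c ν) :
      trace (x * c * z) = trace (x * (c * z)) := by
    rw [mul_comm x c, mem_peirceSpace.1 hx, mem_peirceSpace.1 hz, smul_mul_assoc, mul_smul_comm,
      trace_smul, trace_smul]
    rcases eq_or_ne μ ν with rfl | hμν
    · rfl
    · rw [trace_mul_eq_zero_of_mem_peirceSpace hc hμν hx hz, mul_zero, mul_zero]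
  obtain ⟨x₁, hx₁, u, hu, x₀, hx₀, rfl⟩ := exists_peirce_decomposition ℝ hc x
  obtain ⟨z₁, hz₁, w, hw, z₀, hz₀, rfl⟩ := exists_peirce_decomposition ℝ hc z
  simp only [add_mul, mul_add, trace_add, homogeneous hx₁ hz₁, homogeneous hx₁ hw,
    homogeneous hx₁ hz₀, homogeneous hu hz₁, homogeneous hu hw, homogeneous hu hz₀,
    homogeneous hx₀ hz₁, homogeneous hx₀ hw, homogeneous hx₀ hz₀]

theorem trace_mul_assoc (x y z : A) : trace (x * y * z) = trace (x * (y * z)) := by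
  obtain ⟨n, c, l, hc, rfl⟩ := exists_spectral_frame y
  simp only [Finset.sum_mul, Finset.mul_sum, smul_mul_assoc, mul_smul_comm, trace_sum, trace_smul,
    trace_mul_assoc_of_isIdempotentElem (hc.isIdempotentElem _)]

theorem trace_mul_eq_peirceCoeff (hc : IsPrimitiveIdempotent c) (x : A) :
    trace (c * x) = peirceCoeff hc x := by
  have trace_quadraticRep := congrArg trace (peirceCoeff_smul hc x)
  rw [quadraticRep_apply, trace_sub, trace_smul, trace_smul, ← trace_mul_assoc, hc.2.1.eq,
    trace_of_isPrimitive hc] at trace_quadraticRep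
  linarith

theorem trace_mul_self_sum_smul {ι : Type*} [Fintype ι] {c : ι → A} (hc : IsFrame c) (l : ι → ℝ) :
    trace ((∑ i, l i • c i) * ∑ i, l i • c i) = ∑ i, l i ^ 2 := by
  simp only [hc.sum_smul_mul_sum_smul, trace_sum_smul hc.isPrimitive, sq]

theorem trace_mul_self_nonneg (x : A) : 0 ≤ trace (x * x) := by
  obtain ⟨n, c, l, hc, rfl⟩ := exists_spectral_frame x
  rw [trace_mul_self_sum_smul hc]
  positivity

theorem trace_mul_self_eq_zero {x : A} : trace (x * x) = 0 ↔ x = 0 := by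
  refine ⟨fun h => ?_, fun h => by rw [h, zero_mul, trace_zero]⟩
  obtain ⟨n, c, l, hc, rfl⟩ := exists_spectral_frame x
  rw [trace_mul_self_sum_smul hc, Finset.sum_eq_zero_iff_of_nonneg fun i _ => sq_nonneg _] at h
  exact Finset.sum_eq_zero fun i hi => by rw [pow_eq_zero_iff two_ne_zero |>.1 (h i hi), zero_smul]

theorem trace_mul_mul_mul_le (hc : IsIdempotentElem c) (y : A) :
    trace (c * y * (c * y)) ≤ trace (c * (y * y)) := by
  -- With `L = mulLeft c`, `L - L²` is a quarter of the projection onto the Peirce space of `1 / 2`.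
  set w := c * y - c * (c * y) with hw
  have hcw : c * w = (1 / 2 : ℝ) • w := by
    rw [hw, mul_sub]
    linear_combination (norm := module) (-1 / 2 : ℝ) • peirce_cubic ℝ hc y
  have symmetric (x z : A) : trace (c * x * z) = trace (x * (c * z)) := by
    rw [mul_comm c, trace_mul_assoc]
  have difference : trace (c * (y * y)) - trace (c * y * (c * y)) = trace (y * w) := by
    rw [← trace_mul_assoc, symmetric, symmetric, ← trace_sub, ← mul_sub]
  have sq_w : trace (w * w) = 1 / 4 * trace (y * w) := by
    nth_rewrite 1 [hw]
    rw [sub_mul, trace_sub, symmetric, symmetric, symmetric]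
    simp only [hcw, mul_smul_comm, trace_smul]
    ring
  linarith [trace_mul_self_nonneg w]

theorem trace_mul_mul_self_nonneg (hc : IsIdempotentElem c) (y : A) :
    0 ≤ trace (c * (y * y)) :=
  (trace_mul_self_nonneg (c * y)).trans (trace_mul_mul_mul_le hc y)

theorem mul_eq_zero_of_trace_mul_mul_self_eq_zero (hc : IsIdempotentElem c) {y : A}
    (h : trace (c * (y * y)) = 0) : c * y = 0 :=
  trace_mul_self_eq_zero.1 (((trace_mul_mul_mul_le hc y).trans_eq h).antisymm
    (trace_mul_self_nonneg _))

theorem trace_mul_self_mul_mul_self_nonneg (x y : A) : 0 ≤ trace (x * x * (y * y)) := by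
  obtain ⟨n, c, l, hc, rfl⟩ := exists_spectral_frame x
  simp only [hc.sum_smul_mul_sum_smul, Finset.sum_mul, smul_mul_assoc, trace_sum, trace_smul]
  exact Finset.sum_nonneg fun i _ => mul_nonneg (mul_self_nonneg _)
    (trace_mul_mul_self_nonneg (hc.isIdempotentElem i) y)

theorem trace_mul_nonneg {x y : A} (hx : IsSumSq x) (hy : IsSumSq y) : 0 ≤ trace (x * y) := by
  induction hx with
  | zero => rw [zero_mul, trace_zero]
  | sq_add a _ ihx =>
    rw [add_mul, trace_add]
    refine add_nonneg ?_ ihx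
    clear ihx
    induction hy with
    | zero => rw [mul_zero, trace_zero]
    | sq_add b _ ihy =>
      rw [mul_add, trace_add]
      exact add_nonneg (trace_mul_self_mul_mul_self_nonneg a b) ihy

end Trace

section PositiveCone

variable {A : Type*} [NonUnitalNonAssocCommRing A]

theorem isSumSq_of_isIdempotentElem {c : A} (hc : IsIdempotentElem c) : IsSumSq c :=
  hc.eq ▸ IsSumSq.mul_self c

variable [Module ℝ A] [IsScalarTower ℝ A A] [SMulCommClass ℝ A A]

theorem isSumSq_smul {a : ℝ} (ha : 0 ≤ a) {x : A} (hx : IsSumSq x) : IsSumSq (a • x) := by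
  induction hx with
  | zero =>
    rw [smul_zero]
    exact IsSumSq.zero
  | sq_add y _ ih =>
    have smul_sq : a • (y * y) = (√a • y) * (√a • y) := by
      rw [smul_mul_smul_comm, Real.mul_self_sqrt ha]
    rw [smul_add, smul_sq]
    exact ih.sq_add _

theorem isSumSq_sum_smul {ι : Type*} {s : Finset ι} {l : ι → ℝ} {x : ι → A}
    (hl : ∀ i ∈ s, 0 ≤ l i) (hx : ∀ i ∈ s, IsSumSq (x i)) : IsSumSq (∑ i ∈ s, l i • x i) :=
  IsSumSq.sum fun i hi => isSumSq_smul (hl i hi) (hx i hi)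

theorem convex_positiveCone : Convex ℝ (positiveCone A) := fun _ hx _ hy _ _ ha hb _ =>
  IsSumSq.add (isSumSq_smul ha hx) (isSumSq_smul hb hy)

variable [IsCommJordan A] [IsFormallyReal A] [FiniteDimensional ℝ A]

theorem trace_mul_nonneg_of_isIdempotentElem {c d : A} (hc : IsIdempotentElem c)
    (hd : IsIdempotentElem d) : 0 ≤ trace (c * d) :=
  trace_mul_nonneg (isSumSq_of_isIdempotentElem hc) (isSumSq_of_isIdempotentElem hd)

theorem IsFrame.trace_sum_smul_mul {ι : Type*} [Fintype ι] {c : ι → A} (hc : IsFrame c)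
    (l : ι → ℝ) (i : ι) : trace ((∑ j, l j • c j) * c i) = l i := by
  rw [hc.sum_smul_mul, trace_smul, trace_of_isPrimitive (hc.isPrimitive i), mul_one]

theorem exists_nonneg_spectral_frame {x : A} (hx : IsSumSq x) :
    ∃ (n : ℕ) (c : Fin n → A) (l : Fin n → ℝ), IsFrame c ∧ (∀ i, 0 ≤ l i) ∧
      x = ∑ i, l i • c i := by
  obtain ⟨n, c, l, hc, rfl⟩ := exists_spectral_frame x
  refine ⟨n, c, l, hc, fun i => ?_, rfl⟩
  rw [← hc.trace_sum_smul_mul l i]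
  exact trace_mul_nonneg hx (isSumSq_of_isIdempotentElem (hc.isIdempotentElem i))

theorem mul_eq_zero_of_trace_mul_eq_zero {x p : A} (hx : IsSumSq x) (hp : IsIdempotentElem p)
    (h : trace (p * x) = 0) : p * x = 0 := by
  obtain ⟨n, c, l, hc, hl, rfl⟩ := exists_nonneg_spectral_frame hx
  simp only [Finset.mul_sum, mul_smul_comm, trace_sum, trace_smul] at h ⊢
  refine Finset.sum_eq_zero fun i hi => smul_eq_zero.2 ?_
  have term_nonneg (i : Fin n) : 0 ≤ l i * trace (p * c i) := mul_nonneg (hl i)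
    (trace_mul_nonneg_of_isIdempotentElem hp (hc.isIdempotentElem i))
  have term_eq_zero := (Finset.sum_eq_zero_iff_of_nonneg fun i _ => term_nonneg i).1 h i hi
  refine (mul_eq_zero.1 term_eq_zero).imp_right fun h => ?_
  exact mul_eq_zero_of_trace_mul_mul_self_eq_zero hp (by rwa [(hc.isIdempotentElem i).eq])

end PositiveCone

section PureStates

variable {A : Type*} [NonUnitalNonAssocCommRing A] [Module ℝ A] [IsScalarTower ℝ A A]
  [SMulCommClass ℝ A A] [IsCommJordan A] [IsFormallyReal A] [FiniteDimensional ℝ A] {a c : A}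

theorem stateSpace_eq_convexHull :
    stateSpace A = convexHull ℝ {c : A | IsPrimitiveIdempotent c} := by
  apply Set.Subset.antisymm
  · rintro x ⟨hx, trace_x⟩
    obtain ⟨n, c, l, hc, hl, rfl⟩ := exists_nonneg_spectral_frame hx
    rw [trace_sum_smul hc.isPrimitive] at trace_x
    exact (convex_convexHull ℝ _).sum_mem (fun i _ => hl i) trace_x
      fun i _ => subset_convexHull ℝ _ (hc.isPrimitive i)
  · refine convexHull_min
      (fun c hc => ⟨isSumSq_of_isIdempotentElem hc.2.1, trace_of_isPrimitive hc⟩) ?_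
    rintro x ⟨hx, trace_x⟩ y ⟨hy, trace_y⟩ a b ha hb hab
    refine ⟨convex_positiveCone hx hy ha hb hab, ?_⟩
    rw [trace_add, trace_smul, trace_smul, trace_x, trace_y, mul_one, mul_one, hab]

theorem exists_complement (hc : IsIdempotentElem c) :
    ∃ p : A, IsIdempotentElem p ∧ ∀ x, p * x = x - c * x := by
  obtain ⟨e, he⟩ := exists_unit A
  refine ⟨e - c, ?_, fun x => by rw [sub_mul, he]⟩
  rw [IsIdempotentElem, sub_mul, he, mul_sub, mul_comm c e, he, hc.eq, sub_self, sub_zero]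

theorem trace_mul_le_one (hc : IsIdempotentElem c) (ha : a ∈ stateSpace A) :
    trace (c * a) ≤ 1 := by
  obtain ⟨p, hp, hpc⟩ := exists_complement hc
  have trace_nonneg := trace_mul_nonneg (isSumSq_of_isIdempotentElem hp) ha.1
  rw [hpc, trace_sub, ha.2] at trace_nonneg
  linarith

theorem eq_of_trace_mul_eq_one (hc : IsPrimitiveIdempotent c) (ha : a ∈ stateSpace A)
    (h : trace (c * a) = 1) : a = c := by
  obtain ⟨p, hp, hpc⟩ := exists_complement hc.2.1
  have complement_mul : p * a = 0 := mul_eq_zero_of_trace_mul_eq_zero ha.1 hp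
    (by rw [hpc, trace_sub, ha.2, h, sub_self])
  rw [hpc, sub_eq_zero] at complement_mul
  obtain ⟨r, rfl⟩ := Submodule.mem_span_singleton.1
    (peirceSpace_one_le_span hc (mem_peirceSpace_one.2 complement_mul.symm))
  have trace_eq_one := ha.2
  rw [trace_smul, trace_of_isPrimitive hc, mul_one] at trace_eq_one
  rw [trace_eq_one, one_smul]

theorem mem_pureStates_iff : c ∈ pureStates A ↔ IsPrimitiveIdempotent c := by
  refine ⟨fun h => ?_, fun hc => ?_⟩
  · rw [pureStates, stateSpace_eq_convexHull] at h
    exact extremePoints_convexHull_subset (A := {c : A | IsPrimitiveIdempotent c}) h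
  refine ⟨⟨isSumSq_of_isIdempotentElem hc.2.1, trace_of_isPrimitive hc⟩, ?_⟩
  rintro a ha b hb ⟨s, t, hs, ht, hst, habc⟩
  have average : s * trace (c * a) + t * trace (c * b) = 1 := by
    rw [← trace_smul, ← trace_smul, ← trace_add, ← mul_smul_comm, ← mul_smul_comm, ← mul_add, habc,
      hc.2.1.eq, trace_of_isPrimitive hc]
  have trace_ca := trace_mul_le_one hc.2.1 ha
  have trace_cb := trace_mul_le_one hc.2.1 hb
  exact eq_of_trace_mul_eq_one hc ha (by nlinarith)

end PureStates

section LogBound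

variable {A : Type*} [NonUnitalNonAssocCommRing A] [IsCommJordan A]

theorem mul_quadraticRep_of_commute {K : Type*} [Field K] [CharZero K] [Module K A]
    [IsScalarTower K A A] [SMulCommClass K A A] {z a : A}
    (h₁ : Commute (LinearMap.mulLeft K z) (LinearMap.mulLeft K a))
    (h₂ : Commute (LinearMap.mulLeft K z) (LinearMap.mulLeft K (a * a))) (x : A) :
    z * quadraticRep K a x = (2 : K) • (z * a * (a * x)) - z * a * a * x := by
  have mulLeft_zaa := DFunLike.congr_fun (mulLeft_mul_mul (K := K) z a a) x
  have comm₁ (y : A) : z * (a * y) = a * (z * y) := DFunLike.congr_fun h₁.eq y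
  have comm₂ : z * (a * a * x) = a * a * (z * x) := DFunLike.congr_fun h₂.eq x
  simp only [LinearMap.sub_apply, LinearMap.add_apply, Module.End.mul_apply,
    LinearMap.mulLeft_apply] at mulLeft_zaa
  rw [comm₁, comm₁] at mulLeft_zaa
  rw [quadraticRep_apply, mul_sub, mul_smul_comm, comm₂, comm₁, comm₁]
  linear_combination (norm := module) mulLeft_zaa

theorem IsOrthogonalSystem.commute_mulLeft {K : Type*} [Field K] [CharZero K] [Module K A]
    [IsScalarTower K A A] [SMulCommClass K A A] {ι : Type*} [Fintype ι] {e : ι → A}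
    (he : IsOrthogonalSystem e) (l m : ι → K) :
    Commute (LinearMap.mulLeft K (∑ i, l i • e i)) (LinearMap.mulLeft K (∑ i, m i • e i)) := by
  have commute_pair (i j : ι) :
      Commute (LinearMap.mulLeft K (e i)) (LinearMap.mulLeft K (e j)) := by
    rcases eq_or_ne i j with rfl | hij
    · exact Commute.refl _
    · have mem_zero : e j ∈ peirceSpace (e i) (0 : K) :=
        mem_peirceSpace_zero.2 (he.mul_eq_zero hij)
      exact LinearMap.ext fun y =>
        mul_left_comm_of_mem_peirceSpace (he.isIdempotentElem i) (by norm_num) mem_zero y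
  have mulLeft_sum (l : ι → K) :
      LinearMap.mulLeft K (∑ i, l i • e i) = ∑ i, l i • LinearMap.mulLeft K (e i) := by
    ext y
    simp [Finset.sum_mul, smul_mul_assoc]
  rw [mulLeft_sum, mulLeft_sum]
  exact Commute.sum_left _ _ _ fun i _ => Commute.sum_right _ _ _ fun j _ =>
    ((commute_pair i j).smul_left _).smul_right _

variable [Module ℝ A] [IsScalarTower ℝ A A] [SMulCommClass ℝ A A] [IsFormallyReal A]
  [FiniteDimensional ℝ A] {s : A} {t : ℝ}

theorem mul_trace_le_one {z a : A} (hs : IsPrimitiveIdempotent s) (ht : 0 ≤ t)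
    (hz : z * quadraticRep ℝ a s = a * s) (hle : IsSumSq (z - t • s)) :
    t * trace (s * a) ≤ 1 := by
  -- Test `z - t • s ≥ 0` against `w * w`: both `z * w` and `s * w` are multiples of `a * s`.
  set w := quadraticRep ℝ a s
  set k := trace (s * a) with hk
  have hsw : s * w = k • (a * s) := by
    rw [hk, trace_mul_eq_peirceCoeff hs, mul_quadraticRep_self]
  have trace_sww : trace (s * (w * w)) = k * trace (a * s * w) := by
    rw [← trace_mul_assoc, hsw, smul_mul_assoc, trace_smul]
  have trace_zww : trace (z * (w * w)) = trace (a * s * w) := by rw [← trace_mul_assoc, hz]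
  have tested := trace_mul_nonneg hle (IsSumSq.mul_self w)
  rw [sub_mul, trace_sub, trace_zww, smul_mul_assoc, trace_smul, trace_sww] at tested
  by_contra! hlt
  have k_pos : 0 < k := pos_of_mul_pos_right (one_pos.trans hlt) ht
  have trace_nonpos : trace (a * s * w) ≤ 0 := by nlinarith
  have trace_sww_eq_zero : trace (s * (w * w)) = 0 :=
    (trace_sww.trans_le (mul_nonpos_of_nonneg_of_nonpos k_pos.le trace_nonpos)).antisymm
      (trace_mul_mul_self_nonneg hs.2.1 w)
  rw [mul_eq_zero_of_trace_mul_mul_self_eq_zero hs.2.1 trace_sww_eq_zero, eq_comm,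
    smul_eq_zero_iff_right k_pos.ne', mul_comm] at hsw
  rw [hk, hsw, trace_zero] at k_pos
  exact k_pos.false

variable {ι : Type*} [Fintype ι] {c : ι → A} {μ : ι → ℝ}

namespace IsFrame

theorem sum_trace_mul (hc : IsFrame c) (x : A) : ∑ i, trace (c i * x) = trace x := by
  rw [← trace_sum, ← Finset.sum_mul, hc.sum_mul]

theorem mul_trace_mul_le (hc : IsFrame c) (hle : IsSumSq (∑ i, μ i • c i - t • s)) (i : ι) :
    t * trace (c i * s) ≤ μ i := by
  have h := trace_mul_nonneg hle (isSumSq_of_isIdempotentElem (hc.isIdempotentElem i))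
  rwa [sub_mul, trace_sub, hc.trace_sum_smul_mul, smul_mul_assoc, trace_smul, mul_comm s,
    sub_nonneg] at h

variable (hc : IsFrame c) (hs : IsPrimitiveIdempotent s) (ht : 0 < t)
  (hle : IsSumSq (∑ i, μ i • c i - t • s))
include hc hs ht hle

theorem trace_mul_eq_zero_of_eq_zero {i : ι} (hi : μ i = 0) : trace (c i * s) = 0 := by
  have trace_nonneg : 0 ≤ trace (c i * s) :=
    trace_mul_nonneg_of_isIdempotentElem (hc.isIdempotentElem i) hs.2.1
  have := hc.mul_trace_mul_le hle i
  rw [hi] at this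
  exact le_antisymm (nonpos_of_mul_nonpos_right this ht) trace_nonneg

theorem sum_mul_inv_smul_mul_self : (∑ i, (μ i * (μ i)⁻¹) • c i) * s = s := by
  conv_rhs => rw [← hc.sum_mul s]
  simp only [Finset.sum_mul, smul_mul_assoc]
  refine Finset.sum_congr rfl fun i _ => ?_
  by_cases hi : μ i = 0
  · rw [mul_eq_zero_of_trace_mul_eq_zero (isSumSq_of_isIdempotentElem hs.2.1)
      (hc.isIdempotentElem i) (hc.trace_mul_eq_zero_of_eq_zero hs ht hle hi), smul_zero]
  · rw [mul_inv_cancel₀ hi, one_smul]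

theorem mul_quadraticRep_sum_inv_smul :
    (∑ i, μ i • c i) * quadraticRep ℝ (∑ i, (μ i)⁻¹ • c i) s = (∑ i, (μ i)⁻¹ • c i) * s := by
  have commute_inv := hc.commute_mulLeft μ fun i => (μ i)⁻¹
  have commute_inv_sq := hc.commute_mulLeft μ fun i => (μ i)⁻¹ * (μ i)⁻¹
  have commute_support := hc.commute_mulLeft (fun i => μ i * (μ i)⁻¹) fun i => (μ i)⁻¹
  rw [← hc.sum_smul_mul_sum_smul] at commute_inv_sq
  have support_mul (x : A) : (∑ i, (μ i * (μ i)⁻¹) • c i) * ((∑ i, (μ i)⁻¹ • c i) * x) =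
      (∑ i, (μ i)⁻¹ • c i) * ((∑ i, (μ i * (μ i)⁻¹) • c i) * x) :=
    DFunLike.congr_fun commute_support.eq x
  rw [mul_quadraticRep_of_commute commute_inv commute_inv_sq, hc.sum_smul_mul_sum_smul,
    hc.sum_smul_mul_sum_smul, support_mul, hc.sum_mul_inv_smul_mul_self hs ht hle]
  have inv_eq (i : ι) : μ i * (μ i)⁻¹ * (μ i)⁻¹ = (μ i)⁻¹ := by
    simpa only [inv_inv] using inv_mul_mul_self (μ i)⁻¹
  simp only [inv_eq]
  module

theorem mul_sum_trace_mul_inv_le_one : t * ∑ i, trace (c i * s) * (μ i)⁻¹ ≤ 1 := by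
  have h := mul_trace_le_one hs ht.le (hc.mul_quadraticRep_sum_inv_smul hs ht hle) hle
  simpa only [mul_comm s, Finset.sum_mul, smul_mul_assoc, trace_sum, trace_smul,
    mul_comm (_⁻¹)] using h

theorem log_le_sum_trace_mul_log : Real.log t ≤ ∑ i, trace (c i * s) * Real.log (μ i) := by
  have trace_nonneg (i : ι) : 0 ≤ trace (c i * s) :=
    trace_mul_nonneg_of_isIdempotentElem (hc.isIdempotentElem i) hs.2.1
  have sum_trace : ∑ i, trace (c i * s) = 1 := by rw [hc.sum_trace_mul, trace_of_isPrimitive hs]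
  have term_le (i : ι) : trace (c i * s) * (Real.log t - Real.log (μ i)) ≤
      trace (c i * s) * (t * (μ i)⁻¹ - 1) := by
    by_cases hi : μ i = 0
    · rw [hc.trace_mul_eq_zero_of_eq_zero hs ht hle hi, zero_mul, zero_mul]
    · have μ_pos : 0 < μ i := lt_of_le_of_ne
        ((mul_nonneg ht.le (trace_nonneg i)).trans (hc.mul_trace_mul_le hle i)) (Ne.symm hi)
      rw [← Real.log_div ht.ne' hi, ← div_eq_mul_inv]
      exact mul_le_mul_of_nonneg_left (Real.log_le_sub_one_of_pos (div_pos ht μ_pos))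
        (trace_nonneg i)
  have h := Finset.sum_le_sum fun i (_ : i ∈ Finset.univ) => term_le i
  simp only [mul_sub, Finset.sum_sub_distrib, ← Finset.sum_mul, sum_trace, mul_one, one_mul,
    mul_left_comm _ t, ← Finset.mul_sum] at h
  linarith [hc.mul_sum_trace_mul_inv_le_one hs ht hle]

end IsFrame

end LogBound

section Entropy

variable {A : Type*} [NonUnitalNonAssocCommRing A] [Module ℝ A] [IsScalarTower ℝ A A]
  [SMulCommClass ℝ A A] [IsCommJordan A] [FiniteDimensional ℝ A] [IsFormallyReal A]

theorem IsFrame.sum_mul_log_le {ι κ : Type*} [Fintype ι] [Fintype κ] {c : ι → A}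
    (hc : IsFrame c) {μ : ι → ℝ} {σ : κ → A} (hσ : ∀ j, IsPrimitiveIdempotent (σ j)) {l : κ → ℝ}
    (hl : ∀ j, 0 ≤ l j) (h : ∑ i, μ i • c i = ∑ j, l j • σ j) :
    ∑ j, l j * Real.log (l j) ≤ ∑ i, μ i * Real.log (μ i) := by
  classical
  have isSumSq_sub (j : κ) : IsSumSq (∑ i, μ i • c i - l j • σ j) := by
    rw [h, ← Finset.add_sum_erase _ _ (Finset.mem_univ j), add_sub_cancel_left]
    exact isSumSq_sum_smul (fun i _ => hl i) fun i _ => isSumSq_of_isIdempotentElem (hσ i).2.1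
  have eigenvalue_eq (i : ι) : μ i = ∑ j, l j * trace (c i * σ j) := by
    rw [← hc.trace_sum_smul_mul μ i, h, mul_comm]
    simp only [Finset.mul_sum, mul_smul_comm, trace_sum, trace_smul]
  calc ∑ j, l j * Real.log (l j)
      ≤ ∑ j, l j * ∑ i, trace (c i * σ j) * Real.log (μ i) := by
        refine Finset.sum_le_sum fun j _ => ?_
        obtain l_zero | l_pos := (hl j).eq_or_lt
        · simp only [← l_zero, zero_mul, le_refl]
        · exact mul_le_mul_of_nonneg_left
            (hc.log_le_sum_trace_mul_log (hσ j) l_pos (isSumSq_sub j)) l_pos.le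
    _ = ∑ i, (∑ j, l j * trace (c i * σ j)) * Real.log (μ i) := by
        simp only [Finset.mul_sum, Finset.sum_mul, mul_assoc]
        exact Finset.sum_comm
    _ = ∑ i, μ i * Real.log (μ i) := by simp only [← eigenvalue_eq]

theorem IsFrame.isLeast_spectrumEntropies {n : ℕ} {c : Fin n → A} (hc : IsFrame c)
    {μ : Fin n → ℝ} (hμ : ∀ i, 0 ≤ μ i) :
    IsLeast (spectrumEntropies (∑ i, μ i • c i)) (-∑ i, μ i * Real.log (μ i)) := by
  constructor
  · let π := Tuple.sort fun i => -μ i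
    refine ⟨n, μ ∘ π, ⟨fun i j hij => ?_, fun i => hμ _, c ∘ π,
      fun i => mem_pureStates_iff.2 (hc.isPrimitive _), ?_⟩, ?_⟩
    · exact neg_le_neg_iff.1 (Tuple.monotone_sort (fun i => -μ i) hij)
    · exact (Equiv.sum_comp π fun i => μ i • c i).symm
    · exact congrArg Neg.neg (Equiv.sum_comp π fun i => μ i * Real.log (μ i)).symm
  · rintro _ ⟨m, l, ⟨-, hl, σ, hσ, h⟩, rfl⟩
    exact neg_le_neg (hc.sum_mul_log_le (fun j => mem_pureStates_iff.1 (hσ j)) hl h)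

theorem IsFrame.entropy_sum_smul {n : ℕ} {c : Fin n → A} (hc : IsFrame c) {μ : Fin n → ℝ}
    (hμ : ∀ i, 0 ≤ μ i) : entropy (∑ i, μ i • c i) = ∑ i, Real.negMulLog (μ i) := by
  rw [entropy, (hc.isLeast_spectrumEntropies hμ).csInf_eq, ← Finset.sum_neg_distrib]
  simp only [Real.negMulLog, neg_mul]

theorem IsFrame.entropy_le_sum_negMulLog_trace {κ : Type*} [Fintype κ] {d : κ → A}
    (hd : IsFrame d) {x : A} (hx : IsSumSq x) :
    entropy x ≤ ∑ k, Real.negMulLog (trace (x * d k)) := by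
  obtain ⟨m, c, μ, hc, hμ, rfl⟩ := exists_nonneg_spectral_frame hx
  have sum_weight_right (i : Fin m) : ∑ k, trace (c i * d k) = 1 := by
    simp only [mul_comm (c i), hd.sum_trace_mul, trace_of_isPrimitive (hc.isPrimitive i)]
  have sum_weight_left (k : κ) : ∑ i, trace (c i * d k) = 1 := by
    rw [hc.sum_trace_mul, trace_of_isPrimitive (hd.isPrimitive k)]
  have trace_mul_eq (k : κ) :
      trace ((∑ i, μ i • c i) * d k) = ∑ i, trace (c i * d k) • μ i := by
    simp only [Finset.sum_mul, smul_mul_assoc, trace_sum, trace_smul, smul_eq_mul, mul_comm (μ _)]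
  calc entropy (∑ i, μ i • c i)
      = ∑ i, (∑ k, trace (c i * d k)) * Real.negMulLog (μ i) := by
        simp only [hc.entropy_sum_smul hμ, sum_weight_right, one_mul]
    _ = ∑ k, ∑ i, trace (c i * d k) • Real.negMulLog (μ i) := by
        simp only [Finset.sum_mul, smul_eq_mul]
        exact Finset.sum_comm
    _ ≤ ∑ k, Real.negMulLog (∑ i, trace (c i * d k) • μ i) :=
        Finset.sum_le_sum fun k _ => Real.concaveOn_negMulLog.le_map_sum
          (fun i _ => trace_mul_nonneg_of_isIdempotentElem (hc.isIdempotentElem i)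
            (hd.isIdempotentElem k))
          (sum_weight_left k) fun i _ => hμ i
    _ = ∑ k, Real.negMulLog (trace ((∑ i, μ i • c i) * d k)) := by simp only [trace_mul_eq]

theorem concaveOn_entropy : ConcaveOn ℝ (positiveCone A) (entropy (A := A)) := by
  refine ⟨convex_positiveCone, fun x hx y hy a b ha hb hab => ?_⟩
  obtain ⟨n, d, ν, hd, hν, spectral⟩ :=
    exists_nonneg_spectral_frame (convex_positiveCone hx hy ha hb hab)
  have trace_mul_mem {z : A} (hz : IsSumSq z) (k : Fin n) : trace (z * d k) ∈ Set.Ici (0 : ℝ) :=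
    trace_mul_nonneg hz (isSumSq_of_isIdempotentElem (hd.isIdempotentElem k))
  have eigenvalue_eq (k : Fin n) : a • trace (x * d k) + b • trace (y * d k) = ν k := by
    rw [← hd.trace_sum_smul_mul ν k, ← spectral, add_mul, smul_mul_assoc, smul_mul_assoc,
      trace_add, trace_smul, trace_smul, smul_eq_mul, smul_eq_mul]
  calc a • entropy x + b • entropy y
      ≤ a • ∑ k, Real.negMulLog (trace (x * d k)) + b • ∑ k, Real.negMulLog (trace (y * d k)) := by
        gcongr
        · exact hd.entropy_le_sum_negMulLog_trace hx
        · exact hd.entropy_le_sum_negMulLog_trace hy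
    _ = ∑ k, (a • Real.negMulLog (trace (x * d k)) + b • Real.negMulLog (trace (y * d k))) := by
        rw [Finset.smul_sum, Finset.smul_sum, Finset.sum_add_distrib]
    _ ≤ ∑ k, Real.negMulLog (a • trace (x * d k) + b • trace (y * d k)) :=
        Finset.sum_le_sum fun k _ => Real.concaveOn_negMulLog.2
          (trace_mul_mem hx k) (trace_mul_mem hy k) ha hb hab
    _ = entropy (a • x + b • y) := by
        simp only [eigenvalue_eq, spectral, hd.entropy_sum_smul hν]

end Entropy

end JordanEntropy

theorem mainTheorem2 {A : Type*} [NonUnitalNonAssocCommRing A] [Module ℝ A]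
    [IsScalarTower ℝ A A] [SMulCommClass ℝ A A] [IsCommJordan A] [FiniteDimensional ℝ A]
    [IsFormallyReal A] :
    (∀ x ∈ JordanEntropy.positiveCone A,
      (JordanEntropy.spectrumEntropies x).Nonempty ∧
        BddBelow (JordanEntropy.spectrumEntropies x)) ∧
    ConcaveOn ℝ (JordanEntropy.positiveCone A) (JordanEntropy.entropy (A := A)) := by
  refine ⟨fun x hx => ?_, JordanEntropy.concaveOn_entropy⟩
  obtain ⟨n, c, μ, hc, hμ, rfl⟩ := JordanEntropy.exists_nonneg_spectral_frame hx
  have least := hc.isLeast_spectrumEntropies hμ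
  exact ⟨least.nonempty, least.bddBelow⟩
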